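/- Let $d=(d_n)_{n\ge 0}$ be an increasing sequence of real numbers with $d_n\ge 1$ for all $n\ge 0$ and $d_n\to\infty$. Let $h_d$ be the generalized Hahn space of all complex sequences $x=(x_n)_{n\ge 0}$ with $x_n\to 0$ and $$\|x\|_{h_d}:=\sum_{k=0}^\infty d_k\,|x_{k+1}-x_k|<\infty ,$$ equipped with the norm $\|\cdot\|_{h_d}$. For $t\in[0,1)$ and a complex sequence $x$ put $$C_t x:=\Big(\frac{t^n x_0+t^{n-1}x_1+\dots+x_n}{n+1}\Big)_{n\ge 0}\qquad(\text{with } 0^0=1).$$ Suppose that for each $m\ge 0$ the sequence $\big(d_{m+k+1}/d_k\big)_{k\ge 0}$ is decreasing and that $d_{k+1}/d_k$ decreases to $1$ as $k\to\infty$. (Increasing and decreasing are understood in the non-strict sense.) Then, for every $t\in[0,1)$, $C_t$ maps $h_d$ into $h_d$ and defines a bounded linear operator on $h_d$ that has the following properties. 1. $C_t$ is a compact operator on $h_d$. 2. The set of eigenvalues of $C_t$ on $h_d$ is $\{\frac1{n+1}: n\ge 0\}$, and the spectrum of $C_t$ on $h_d$ is $\{0\}\cup\{\frac1{n+1}: n\ge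 0\}$. 3. $C_t$ is power bounded, i.e. $\sup_{n\ge 1}\|C_t^n\|<\infty$ in operator norm. 4. $C_t$ is uniformly mean ergodic, i.e. the averages $\frac1n\sum_{m=1}^n C_t^m$ converge in operator norm as $n\to\infty$. 5. $C_t$ is not supercyclic, i.e. there is no $x\in h_d$ for which $\{\lambda C_t^n x:\lambda\in\mathbb C,\ n\ge 0\}$ is dense in $h_d$. -/

import Mathlib

open Filter Topology

/-- A weight: a sequence `d = (d_n)` of positive real numbers with `d_n ↑ ∞`. -/
structure HahnWeight where
  seq : ℕ → ℝ
  pos : ∀ n, 0 < seq n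
  mono : Monotone seq
  tendsto_atTop : Tendsto seq atTop atTop

instance : CoeFun HahnWeight (fun _ => ℕ → ℝ) := ⟨HahnWeight.seq⟩

/-- The vector space of all complex null sequences `x` with `∑ d_k |x_{k+1} - x_k| < ∞`. -/
def hahnSubmodule (d : HahnWeight) : Submodule ℂ (ℕ → ℂ) where
  carrier := {x | Tendsto x atTop (𝓝 0) ∧ Summable (fun k => d k * ‖x (k + 1) - x k‖)}
  zero_mem' := by
    refine ⟨tendsto_const_nhds, ?_⟩
    simp
  add_mem' := by
    rintro x y ⟨hx, hx'⟩ ⟨hy, hy'⟩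
    refine ⟨(add_zero (0 : ℂ)) ▸ hx.add hy, ?_⟩
    refine Summable.of_nonneg_of_le (fun k => mul_nonneg (d.pos k).le (norm_nonneg _))
      (fun k => ?_) (hx'.add hy')
    rw [← mul_add]
    refine mul_le_mul_of_nonneg_left ?_ (d.pos k).le
    have : (x + y) (k + 1) - (x + y) k = (x (k + 1) - x k) + (y (k + 1) - y k) := by
      simp only [Pi.add_apply]; ring
    rw [this]
    exact norm_add_le _ _
  smul_mem' := by
    rintro c x ⟨hx, hx'⟩
    refine ⟨(mul_zero c) ▸ hx.const_mul c, ?_⟩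
    refine (hx'.mul_left ‖c‖).congr (fun k => ?_)
    simp only [Pi.smul_apply, smul_eq_mul, ← mul_sub, norm_mul]
    ring

/-- The generalized Hahn space `h_d`. It is a type synonym, so that it carries the topology of its
norm (defined below) and not the one of coordinatewise convergence. -/
def HahnSpace (d : HahnWeight) : Type := hahnSubmodule d

namespace HahnSpace

variable {d : HahnWeight}

noncomputable instance : AddCommGroup (HahnSpace d) :=
  inferInstanceAs (AddCommGroup (hahnSubmodule d))

noncomputable instance : Module ℂ (HahnSpace d) :=
  inferInstanceAs (Module ℂ (hahnSubmodule d))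

/-- The sequence underlying an element of `h_d`. -/
def toSeq (x : HahnSpace d) : ℕ → ℂ := Subtype.val (p := fun y => y ∈ hahnSubmodule d) x

instance : CoeFun (HahnSpace d) (fun _ => ℕ → ℂ) := ⟨toSeq⟩

theorem ext {x y : HahnSpace d} (h : ∀ n, x n = y n) : x = y := Subtype.ext (funext h)

theorem tendsto_zero (x : HahnSpace d) : Tendsto x.toSeq atTop (𝓝 0) :=
  (Subtype.prop (p := fun y => y ∈ hahnSubmodule d) x).1

theorem summable (x : HahnSpace d) : Summable (fun k => d k * ‖x (k + 1) - x k‖) :=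
  (Subtype.prop (p := fun y => y ∈ hahnSubmodule d) x).2

@[simp] theorem zero_apply (n : ℕ) : (0 : HahnSpace d) n = 0 := rfl

@[simp] theorem add_apply (x y : HahnSpace d) (n : ℕ) : (x + y) n = x n + y n := rfl

@[simp] theorem smul_apply (c : ℂ) (x : HahnSpace d) (n : ℕ) : (c • x) n = c * x n := rfl

/-- The norm `‖x‖ = ∑ d_k |x_{k+1} - x_k|`. -/
noncomputable instance : Norm (HahnSpace d) := ⟨fun x => ∑' k, d k * ‖x (k + 1) - x k‖⟩

theorem norm_def (x : HahnSpace d) : ‖x‖ = ∑' k, d k * ‖x (k + 1) - x k‖ := rfl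

theorem normedSpaceCore (d : HahnWeight) : NormedSpace.Core ℂ (HahnSpace d) where
  norm_nonneg x := tsum_nonneg fun k => mul_nonneg (d.pos k).le (norm_nonneg _)
  norm_smul c x := by
    rw [norm_def, norm_def, ← tsum_mul_left]
    refine tsum_congr fun k => ?_
    simp only [smul_apply, ← mul_sub, norm_mul]
    ring
  norm_triangle x y := by
    rw [norm_def, norm_def, norm_def, ← x.summable.tsum_add y.summable]
    refine (x + y).summable.tsum_le_tsum (fun k => ?_) (x.summable.add y.summable)
    rw [← mul_add]
    refine mul_le_mul_of_nonneg_left ?_ (d.pos k).le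
    rw [add_apply, add_apply, add_sub_add_comm]
    exact norm_add_le _ _
  norm_eq_zero_iff x := by
    constructor
    · intro h
      have hz : ∀ k, d k * ‖x (k + 1) - x k‖ = 0 := by
        have h0 := (hasSum_zero_iff_of_nonneg
          (fun k => mul_nonneg (d.pos k).le (norm_nonneg (x (k + 1) - x k)))).1
          ((norm_def x).symm.trans h ▸ x.summable.hasSum)
        exact fun k => congrFun h0 k
      have hs : ∀ k, x (k + 1) = x k := fun k => by
        rcases mul_eq_zero.1 (hz k) with h1 | h1
        · exact absurd h1 (d.pos k).ne'
        · exact sub_eq_zero.1 (norm_eq_zero.1 h1)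
      have hc : ∀ k, x k = x 0 := fun k => by
        induction k with
        | zero => rfl
        | succ k ih => rw [hs, ih]
      have h0 : x 0 = 0 := by
        refine tendsto_nhds_unique ?_ x.tendsto_zero
        exact tendsto_const_nhds.congr fun k => (hc k).symm
      exact ext fun n => by rw [hc, h0, zero_apply]
    · rintro rfl
      simp [norm_def]

noncomputable instance : NormedAddCommGroup (HahnSpace d) :=
  NormedAddCommGroup.ofCore (normedSpaceCore d)

noncomputable instance : NormedSpace ℂ (HahnSpace d) :=
  NormedSpace.ofCore (normedSpaceCore d)

end HahnSpace

/-- The generalized Cesàro operator on the space of all complex sequences,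
`(C_t x)_n = (t^n x_0 + t^(n-1) x_1 + ⋯ + x_n) / (n + 1)`. -/
noncomputable def genCesaro (t : ℝ) : (ℕ → ℂ) →ₗ[ℂ] (ℕ → ℂ) where
  toFun x n := (∑ k ∈ Finset.range (n + 1), (t : ℂ) ^ (n - k) * x k) / (n + 1)
  map_add' x y := by
    funext n
    simp only [Pi.add_apply, mul_add, Finset.sum_add_distrib, add_div]
  map_smul' c x := by
    funext n
    simp only [Pi.smul_apply, smul_eq_mul, RingHom.id_apply, mul_left_comm _ c, ← Finset.mul_sum,
      mul_div_assoc]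

section Operators

variable {E : Type*} [NormedAddCommGroup E] [NormedSpace ℂ E]

/-- The set of eigenvalues of a bounded operator. -/
def pointSpectrum (T : E →L[ℂ] E) : Set ℂ :=
  {μ | Module.End.HasEigenvalue (T : E →ₗ[ℂ] E) μ}

def IsPowerBounded (T : E →L[ℂ] E) : Prop :=
  ∃ M : ℝ, ∀ n : ℕ, 1 ≤ n → ‖T ^ n‖ ≤ M

/-- The averages `(T + T² + ⋯ + Tⁿ) / n`. -/
noncomputable def cesaroMean (T : E →L[ℂ] E) (n : ℕ) : E →L[ℂ] E :=
  (n : ℂ)⁻¹ • ∑ m ∈ Finset.Icc 1 n, T ^ m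

/-- The averages of `T` converge in operator norm. -/
def IsUniformlyMeanErgodic (T : E →L[ℂ] E) : Prop :=
  ∃ P : E →L[ℂ] E, Tendsto (cesaroMean T) atTop (𝓝 P)

/-- Some projective orbit `{c Tⁿ x : c ∈ ℂ, n ≥ 0}` is dense. -/
def IsSupercyclic (T : E →L[ℂ] E) : Prop :=
  ∃ x : E, Dense {y : E | ∃ (c : ℂ) (n : ℕ), y = c • (T ^ n) x}

end Operators

/-- The set `{1/(n+1) : n ≥ 0}`. -/
def cesaroLambda : Set ℂ := Set.range fun n : ℕ => 1 / ((n : ℂ) + 1)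

/-! ### Coordinates and completeness of `h_d`. -/

namespace HahnSpace

variable {d : HahnWeight}

/-! Write `e_k` for the indicator of `{0, …, k}`. Then `‖e_k‖ = d_k` and `x = ∑ (x_k - x_{k+1})
e_k`, so `h_d` is a weighted `ℓ¹`. An operator is bounded as soon as its columns are `O(d_k)`, and
compact if they are `o(d_k)` (`isCompactOperator_ofColumns`). For `C_t` the columns are explicit:
differences of order `1/n²` up to `k`, geometric decay after it, so
`tsum_weight_cesaroColumn_div_le` gives compactness.

`C_t` is lower triangular with diagonal `1/(n+1)`, so it has no other eigenvalues; the sequences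
`choose n m * t^(n-m)` are eigenvectors and lie in `h_d` by the ratio test. Compactness turns this
into the whole spectrum.

With `P x = x_0 (t^n)_n`, the spectral radius of `C_t - P` is at most `1/2`, hence `C_t^n → P` in
norm, which gives power boundedness and mean ergodicity. Two eigenfunctionals of the transpose
exclude supercyclicity. -/

theorem norm_sub_succ_le (x : HahnSpace d) (k : ℕ) :
    ‖x k - x (k + 1)‖ ≤ (d 0)⁻¹ * (d k * ‖x (k + 1) - x k‖) := by
  rw [norm_sub_rev, ← mul_assoc]
  refine le_mul_of_one_le_left (norm_nonneg _) ?_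
  rw [inv_mul_eq_div, one_le_div (d.pos 0)]
  exact d.mono (Nat.zero_le k)

/-- Every coordinate is the sum of the successive differences that follow it. -/
theorem hasSum_sub_succ (x : HahnSpace d) (n : ℕ) :
    HasSum (fun k => if n ≤ k then x k - x (k + 1) else 0) (x n) := by
  have hs : Summable fun k => ‖if n ≤ k then x k - x (k + 1) else 0‖ := by
    refine Summable.of_nonneg_of_le (fun _ => norm_nonneg _) (fun k => ?_)
      (x.summable.mul_left (d 0)⁻¹)
    refine le_trans ?_ (x.norm_sub_succ_le k)
    split_ifs <;> simp
  rw [hasSum_iff_tendsto_nat_of_summable_norm hs]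
  have h1 : ∀ N, n ≤ N →
      ∑ k ∈ Finset.range N, (if n ≤ k then x k - x (k + 1) else 0) = x n - x N := by
    intro N hN
    induction N, hN using Nat.le_induction with
    | base =>
      rw [sub_self]
      refine Finset.sum_eq_zero fun k hk => if_neg ?_
      simpa using hk
    | succ N hN ih => rw [Finset.sum_range_succ, ih, if_pos hN]; ring
  have h2 : Tendsto (fun N => x n - x N) atTop (𝓝 (x n)) := by
    simpa using tendsto_const_nhds.sub x.tendsto_zero
  refine h2.congr' ?_
  filter_upwards [eventually_ge_atTop n] with N hN using (h1 N hN).symm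

theorem norm_apply_le (x : HahnSpace d) (n : ℕ) : ‖x n‖ ≤ (d 0)⁻¹ * ‖x‖ := by
  refine (x.hasSum_sub_succ n).norm_le_of_bounded (x.summable.hasSum.mul_left (d 0)⁻¹)
    fun k => ?_
  refine le_trans ?_ (x.norm_sub_succ_le k)
  split_ifs <;> simp

/-- The coordinate functionals. -/
noncomputable def coord (d : HahnWeight) (n : ℕ) : HahnSpace d →L[ℂ] ℂ :=
  LinearMap.mkContinuous
    { toFun := fun x => x n
      map_add' := fun _ _ => rfl
      map_smul' := fun _ _ => rfl } (d 0)⁻¹ fun x => x.norm_apply_le n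

@[simp] theorem coord_apply (n : ℕ) (x : HahnSpace d) : coord d n x = x n := rfl

/-- The element of `h_d` given by a sequence that satisfies the two conditions. -/
def mk (x : ℕ → ℂ) (h0 : Tendsto x atTop (𝓝 0))
    (h : Summable fun k => d k * ‖x (k + 1) - x k‖) : HahnSpace d :=
  (⟨x, h0, h⟩ : hahnSubmodule d)

theorem tendsto_zero_of_summable {x : ℕ → ℂ} (h : Summable fun k => d k * ‖x k‖) :
    Tendsto x atTop (𝓝 0) := by
  rw [tendsto_zero_iff_norm_tendsto_zero]
  refine squeeze_zero (fun _ => norm_nonneg _) (fun n => ?_)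
    (by simpa using h.tendsto_atTop_zero.const_mul (d 0)⁻¹)
  rw [← mul_assoc]
  refine le_mul_of_one_le_left (norm_nonneg _) ?_
  rw [inv_mul_eq_div, one_le_div (d.pos 0)]
  exact d.mono (Nat.zero_le n)

theorem summable_diff_of_summable {x : ℕ → ℂ} (h : Summable fun k => d k * ‖x k‖) :
    Summable fun k => d k * ‖x (k + 1) - x k‖ := by
  refine Summable.of_nonneg_of_le (fun k => mul_nonneg (d.pos k).le (norm_nonneg _))
    (fun k => ?_) (((summable_nat_add_iff 1).2 h).add h)
  calc d k * ‖x (k + 1) - x k‖ ≤ d k * (‖x (k + 1)‖ + ‖x k‖) :=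
        mul_le_mul_of_nonneg_left (norm_sub_le _ _) (d.pos k).le
    _ = d k * ‖x (k + 1)‖ + d k * ‖x k‖ := mul_add _ _ _
    _ ≤ d (k + 1) * ‖x (k + 1)‖ + d k * ‖x k‖ := by
        gcongr
        exact d.mono (Nat.le_succ k)

/-- The element of `h_d` given by a sequence that is absolutely summable with weight `d`. -/
def ofSummable (x : ℕ → ℂ) (h : Summable fun k => d k * ‖x k‖) : HahnSpace d :=
  mk x (tendsto_zero_of_summable h) (summable_diff_of_summable h)

/-- The weighted difference map `x ↦ (d_k (x_{k+1} - x_k))` into `ℓ¹`. -/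
noncomputable def diffL1 (d : HahnWeight) : HahnSpace d →ₗ[ℂ] lp (fun _ : ℕ => ℂ) 1 where
  toFun x := ⟨fun k => (d k : ℂ) * (x (k + 1) - x k), by
    refine memℓp_gen ?_
    simpa [abs_of_pos (d.pos _)] using x.summable⟩
  map_add' x y := by
    ext k
    simp only [add_apply, lp.coeFn_add, Pi.add_apply]
    ring
  map_smul' c x := by
    ext k
    simp only [smul_apply, lp.coeFn_smul, Pi.smul_apply, smul_eq_mul, RingHom.id_apply]
    ring

theorem diffL1_apply (x : HahnSpace d) (k : ℕ) :
    diffL1 d x k = (d k : ℂ) * (x (k + 1) - x k) := rfl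

theorem norm_diffL1 (x : HahnSpace d) : ‖diffL1 d x‖ = ‖x‖ := by
  rw [lp.norm_eq_tsum_rpow (by simp), norm_def]
  simp [diffL1_apply, abs_of_pos (d.pos _)]

theorem diffL1_surjective : Function.Surjective (diffL1 d) := by
  intro y
  have hy : Summable fun k => ‖y k‖ := by
    simpa using (lp.memℓp y).summable (by simp)
  have hd : ∀ k, (d k : ℂ) ≠ 0 := fun k => Complex.ofReal_ne_zero.2 (d.pos k).ne'
  have hz : Summable fun k => y k / (d k : ℂ) := by
    refine Summable.of_norm_bounded (hy.mul_left (d 0)⁻¹) fun k => ?_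
    rw [norm_div, Complex.norm_real, Real.norm_of_nonneg (d.pos k).le, div_eq_inv_mul]
    exact mul_le_mul_of_nonneg_right (inv_anti₀ (d.pos 0) (d.mono (Nat.zero_le k)))
      (norm_nonneg _)
  have hstep : ∀ n, (-∑' k, y (k + (n + 1)) / (d (k + (n + 1)) : ℂ))
      - (-∑' k, y (k + n) / (d (k + n) : ℂ)) = y n / d n := by
    intro n
    have h := ((summable_nat_add_iff n).2 hz).tsum_eq_zero_add
    have h' : ∀ k, k + 1 + n = k + (n + 1) := fun k => by ring
    simp only [zero_add, h'] at h
    rw [h]; ring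
  have hdiff : ∀ n, (d n : ℂ) * ((-∑' k, y (k + (n + 1)) / (d (k + (n + 1)) : ℂ))
      - (-∑' k, y (k + n) / (d (k + n) : ℂ))) = y n := fun n => by
    rw [hstep, mul_div_cancel₀ _ (hd n)]
  -- Summing the prescribed differences back from infinity is the only choice that tends to `0`.
  refine ⟨mk (fun n => -∑' k, y (k + n) / (d (k + n) : ℂ)) ?_ ?_, ?_⟩
  · simpa using (tendsto_sum_nat_add fun k => y k / (d k : ℂ)).neg
  · refine hy.congr fun n => ?_
    rw [← hdiff n, norm_mul, Complex.norm_real, Real.norm_of_nonneg (d.pos n).le]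
  · ext n
    exact hdiff n

instance : CompleteSpace (HahnSpace d) := by
  have hi : Isometry (diffL1 d) := AddMonoidHomClass.isometry_of_norm _ norm_diffL1
  rw [completeSpace_iff_isComplete_range hi.isUniformInducing,
    diffL1_surjective.range_eq]
  exact isComplete_univ

/-! ### Operators given by their columns. -/

section OfColumns

variable {E : Type*} [NormedAddCommGroup E] [NormedSpace ℂ E] [CompleteSpace E]

omit [CompleteSpace E] in
theorem norm_smul_column_le {c : ℕ → E} {M : ℝ} (hc : ∀ k, ‖c k‖ ≤ M * d k) (x : HahnSpace d)
    (k : ℕ) : ‖(x k - x (k + 1)) • c k‖ ≤ M * (d k * ‖x (k + 1) - x k‖) := by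
  rw [norm_smul, norm_sub_rev]
  calc ‖x (k + 1) - x k‖ * ‖c k‖ ≤ ‖x (k + 1) - x k‖ * (M * d k) :=
        mul_le_mul_of_nonneg_left (hc k) (norm_nonneg _)
    _ = _ := by ring

theorem summable_smul_column {c : ℕ → E} {M : ℝ} (hc : ∀ k, ‖c k‖ ≤ M * d k)
    (x : HahnSpace d) : Summable fun k => (x k - x (k + 1)) • c k :=
  Summable.of_norm_bounded (x.summable.mul_left M) (norm_smul_column_le hc x)

/-- The bounded operator that sends the indicator sequence of `{0, …, k}` to `c k`. -/
noncomputable def ofColumns (c : ℕ → E) (M : ℝ) (hc : ∀ k, ‖c k‖ ≤ M * d k) :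
    HahnSpace d →L[ℂ] E :=
  LinearMap.mkContinuous
    { toFun := fun x => ∑' k, (x k - x (k + 1)) • c k
      map_add' := fun x y => by
        rw [← (summable_smul_column hc x).tsum_add (summable_smul_column hc y)]
        refine tsum_congr fun k => ?_
        rw [← add_smul, add_apply, add_apply, add_sub_add_comm]
      map_smul' := fun a x => by
        rw [RingHom.id_apply, ← (summable_smul_column hc x).tsum_const_smul]
        refine tsum_congr fun k => ?_
        rw [smul_smul, smul_apply, smul_apply, mul_sub] } M
    fun x => tsum_of_norm_bounded (x.summable.hasSum.mul_left M) (norm_smul_column_le hc x)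

theorem ofColumns_apply (c : ℕ → E) (M : ℝ) (hc : ∀ k, ‖c k‖ ≤ M * d k) (x : HahnSpace d) :
    ofColumns c M hc x = ∑' k, (x k - x (k + 1)) • c k := rfl

/-- Keeping the first `N` columns gives a finite-rank operator, and the error is at most `sup_{k ≥
N} ‖c k‖ / d k` in norm. -/
theorem isCompactOperator_ofColumns (c : ℕ → E) (M : ℝ) (hc : ∀ k, ‖c k‖ ≤ M * d k)
    (h0 : Tendsto (fun k => ‖c k‖ / d k) atTop (𝓝 0)) :
    IsCompactOperator (ofColumns c M hc) := by
  let F : ℕ → HahnSpace d →L[ℂ] E := fun N =>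
    ∑ k ∈ Finset.range N, (coord d k - coord d (k + 1)).smulRight (c k)
  have hFx : ∀ N x, F N x = ∑ k ∈ Finset.range N, (x k - x (k + 1)) • c k := fun N x => by
    simp [F]
  have hF : ∀ N, IsCompactOperator (F N) := fun N => by
    simp only [F]
    refine Submodule.sum_mem (compactOperator (RingHom.id ℂ) (HahnSpace d) E) fun k _ => ?_
    exact (isCompactOperator_of_locallyCompactSpace_dom
      (coord d k - coord d (k + 1))).clm_comp
        ((ContinuousLinearMap.id ℂ ℂ).smulRight (c k))
  refine isCompactOperator_of_tendsto (l := atTop) (F := F) ?_ (Eventually.of_forall hF)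
  rw [Metric.tendsto_atTop]
  intro ε hε
  have hev := (h0.eventually (gt_mem_nhds (half_pos hε)))
  obtain ⟨N₀, hN₀⟩ := eventually_atTop.1 hev
  refine ⟨N₀, fun N hN => ?_⟩
  rw [dist_eq_norm, norm_sub_rev]
  refine lt_of_le_of_lt (ContinuousLinearMap.opNorm_le_bound _ (half_pos hε).le fun x => ?_)
    (half_lt_self hε)
  have hs := summable_smul_column hc x
  rw [sub_apply, hFx, ofColumns_apply, ← hs.sum_add_tsum_nat_add N,
    add_sub_cancel_left]
  have hb : ∀ k, ‖(x (k + N) - x (k + N + 1)) • c (k + N)‖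
      ≤ ε / 2 * (d (k + N) * ‖x (k + N + 1) - x (k + N)‖) := fun k => by
    have h1 : ‖c (k + N)‖ ≤ ε / 2 * d (k + N) :=
      ((div_lt_iff₀ (d.pos _)).1 (hN₀ (k + N) (by omega))).le
    rw [norm_smul, norm_sub_rev]
    calc _ ≤ ‖x (k + N + 1) - x (k + N)‖ * (ε / 2 * d (k + N)) :=
          mul_le_mul_of_nonneg_left h1 (norm_nonneg _)
      _ = _ := by ring
  have hx' := (summable_nat_add_iff N).2 x.summable
  refine (tsum_of_norm_bounded (hx'.hasSum.mul_left (ε / 2)) hb).trans ?_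
  refine mul_le_mul_of_nonneg_left ?_ (half_pos hε).le
  rw [norm_def, ← x.summable.sum_add_tsum_nat_add N]
  exact le_add_of_nonneg_left
    (Finset.sum_nonneg fun k _ => mul_nonneg (d.pos k).le (norm_nonneg _))

end OfColumns

end HahnSpace

/-! ### Recurrence and eigenvectors of `C_t`. -/

theorem genCesaro_apply (t : ℝ) (x : ℕ → ℂ) (n : ℕ) :
    genCesaro t x n = (∑ k ∈ Finset.range (n + 1), (t : ℂ) ^ (n - k) * x k) / (n + 1) := rfl

theorem genCesaro_zero (t : ℝ) (x : ℕ → ℂ) : genCesaro t x 0 = x 0 := by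
  simp [genCesaro_apply]

theorem genCesaro_succ (t : ℝ) (x : ℕ → ℂ) (n : ℕ) :
    ((n : ℂ) + 2) * genCesaro t x (n + 1) =
      t * (((n : ℂ) + 1) * genCesaro t x n) + x (n + 1) := by
  have h1 : (n : ℂ) + 1 ≠ 0 := by exact_mod_cast n.succ_ne_zero
  have h2 : (n : ℂ) + 2 ≠ 0 := by exact_mod_cast (n + 1).succ_ne_zero
  have h3 : ((n + 1 : ℕ) : ℂ) + 1 = n + 2 := by push_cast; ring
  rw [genCesaro_apply, genCesaro_apply, h3, mul_div_cancel₀ _ h1, mul_div_cancel₀ _ h2,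
    Finset.sum_range_succ _ (n + 1), Finset.mul_sum, Nat.sub_self, pow_zero, one_mul]
  congr 1
  refine Finset.sum_congr rfl fun k hk => ?_
  have hk' : k ≤ n := Nat.lt_succ_iff.1 (Finset.mem_range.1 hk)
  rw [Nat.succ_sub hk', pow_succ]
  ring

theorem genCesaro_of_forall_lt {t : ℝ} {x : ℕ → ℂ} {n : ℕ} (h : ∀ k < n, x k = 0) :
    genCesaro t x n = x n / (n + 1) := by
  rw [genCesaro_apply, Finset.sum_range_succ, Finset.sum_eq_zero, Nat.sub_self, pow_zero,
    one_mul, zero_add]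
  intro k hk
  rw [h k (Finset.mem_range.1 hk), mul_zero]

/-- An eigenvalue of `C_t` is `1 / (n + 1)`, `n` the first index at which the eigenvector does not
vanish. -/
theorem exists_eq_of_genCesaro_eq {t : ℝ} {x : ℕ → ℂ} {μ : ℂ} (hx : ∃ n, x n ≠ 0)
    (h : ∀ n, genCesaro t x n = μ * x n) : ∃ n : ℕ, x n ≠ 0 ∧ μ = 1 / ((n : ℂ) + 1) := by
  classical
  refine ⟨Nat.find hx, Nat.find_spec hx, ?_⟩
  have h0 : ∀ k < Nat.find hx, x k = 0 := fun k hk => not_not.1 (Nat.find_min hx hk)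
  have h1 := h (Nat.find hx)
  rw [genCesaro_of_forall_lt h0] at h1
  refine mul_right_cancel₀ (Nat.find_spec hx) ?_
  rw [← h1]
  ring

/-- The eigenvector of `C_t` for the eigenvalue `1 / (m + 1)`. -/
noncomputable def cesaroEigenSeq (t : ℝ) (m n : ℕ) : ℂ := (n.choose m : ℂ) * (t : ℂ) ^ (n - m)

/-- Stated without division so that it also covers `n < m`; at `n + 1 = m` the left factor vanishes.
-/
theorem cesaroEigenSeq_succ (t : ℝ) (m n : ℕ) :
    cesaroEigenSeq t m (n + 1) * ((n : ℂ) + 1 - m) =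
      t * (((n : ℂ) + 1) * cesaroEigenSeq t m n) := by
  unfold cesaroEigenSeq
  rcases le_or_gt m n with h | h
  · have h1 : ((n.choose m : ℕ) : ℂ) * ((n : ℂ) + 1) =
        ((n + 1).choose m : ℂ) * ((n : ℂ) + 1 - m) := by
      have := congrArg (Nat.cast : ℕ → ℂ) (Nat.choose_mul_succ_eq n m)
      rw [Nat.cast_mul, Nat.cast_mul, Nat.cast_sub (by omega)] at this
      simpa using this
    rw [Nat.succ_sub h, pow_succ]
    linear_combination (-(t : ℂ) ^ (n - m) * t) * h1
  · rw [Nat.choose_eq_zero_of_lt h]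
    rcases eq_or_lt_of_le (Nat.succ_le_of_lt h) with rfl | h'
    · simp
    · rw [Nat.choose_eq_zero_of_lt h']
      simp

theorem genCesaro_cesaroEigenSeq (t : ℝ) (m n : ℕ) :
    genCesaro t (cesaroEigenSeq t m) n = 1 / ((m : ℂ) + 1) * cesaroEigenSeq t m n := by
  have hm : (m : ℂ) + 1 ≠ 0 := by exact_mod_cast m.succ_ne_zero
  induction n with
  | zero =>
    rw [genCesaro_zero]
    cases m <;> simp [cesaroEigenSeq]
  | succ n ih =>
    have h2 : (n : ℂ) + 2 ≠ 0 := by exact_mod_cast (n + 1).succ_ne_zero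
    refine mul_left_cancel₀ h2 ?_
    rw [genCesaro_succ, ih]
    have h := cesaroEigenSeq_succ t m n
    field_simp
    linear_combination -h

theorem cesaroEigenSeq_self (t : ℝ) (m : ℕ) : cesaroEigenSeq t m m = 1 := by
  simp [cesaroEigenSeq]

theorem cesaroEigenSeq_zero (t : ℝ) (n : ℕ) : cesaroEigenSeq t 0 n = (t : ℂ) ^ n := by
  simp [cesaroEigenSeq]

/-- Ratio test: consecutive terms have quotient `(d_{n+1}/d_n) · t(n+1)/(n+1-m)`, in the limit `t <
1`. -/
theorem summable_weight_cesaroEigenSeq (d : HahnWeight)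
    (hd : Tendsto (fun k : ℕ => d (k + 1) / d k) atTop (𝓝 1)) {t : ℝ} (ht0 : 0 ≤ t)
    (ht1 : t < 1) (m : ℕ) : Summable fun n => d n * ‖cesaroEigenSeq t m n‖ := by
  obtain ⟨r, hr, hr1⟩ := exists_between ht1
  refine summable_of_ratio_norm_eventually_le hr1 ?_
  have h1 : Tendsto (fun n : ℕ => ((n + 1 : ℕ) : ℝ) / ((n + 1 : ℕ) + (-(m : ℝ)))) atTop (𝓝 1) :=
    (tendsto_natCast_div_add_atTop (-(m : ℝ))).comp (tendsto_add_atTop_nat 1)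
  have h2 := hd.mul (h1.const_mul t)
  rw [mul_one, one_mul] at h2
  filter_upwards [h2.eventually (gt_mem_nhds hr), eventually_ge_atTop m] with n hn hmn
  have hpos : (0 : ℝ) < (n : ℝ) + 1 - m := by
    have : (m : ℝ) ≤ n := by exact_mod_cast hmn
    linarith
  have hrec : ‖cesaroEigenSeq t m (n + 1)‖ * ((n : ℝ) + 1 - m) =
      t * (((n : ℝ) + 1) * ‖cesaroEigenSeq t m n‖) := by
    have h := congrArg norm (cesaroEigenSeq_succ t m n)
    have e1 : (n : ℂ) + 1 - m = (((n : ℝ) + 1 - m : ℝ) : ℂ) := by push_cast; rfl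
    have e2 : (n : ℂ) + 1 = (((n : ℝ) + 1 : ℝ) : ℂ) := by push_cast; rfl
    rw [e1, e2, norm_mul, norm_mul, norm_mul, Complex.norm_real, Complex.norm_real,
      Complex.norm_real, Real.norm_of_nonneg hpos.le, Real.norm_of_nonneg ht0,
      Real.norm_of_nonneg (by positivity)] at h
    exact h
  have hA := d.pos n
  have hB := d.pos (n + 1)
  rw [Real.norm_of_nonneg (mul_nonneg hB.le (norm_nonneg _)),
    Real.norm_of_nonneg (mul_nonneg hA.le (norm_nonneg _))]
  have hv : ‖cesaroEigenSeq t m (n + 1)‖ =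
      t * (((n : ℝ) + 1) * ‖cesaroEigenSeq t m n‖) / ((n : ℝ) + 1 - m) :=
    (eq_div_iff hpos.ne').2 hrec
  have he : d (n + 1) * ‖cesaroEigenSeq t m (n + 1)‖ =
      (d (n + 1) / d n * (t * (((n + 1 : ℕ) : ℝ) / ((n + 1 : ℕ) + (-(m : ℝ)))))) *
        (d n * ‖cesaroEigenSeq t m n‖) := by
    rw [hv, ← sub_eq_add_neg]
    push_cast
    field_simp
  rw [he]
  exact mul_le_mul_of_nonneg_right hn.le (mul_nonneg hA.le (norm_nonneg _))

theorem summable_weight_mul_pow (d : HahnWeight)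
    (hd : Tendsto (fun k : ℕ => d (k + 1) / d k) atTop (𝓝 1)) {t : ℝ} (ht0 : 0 ≤ t)
    (ht1 : t < 1) : Summable fun n => d n * t ^ n := by
  refine (summable_weight_cesaroEigenSeq d hd ht0 ht1 0).congr fun n => ?_
  rw [cesaroEigenSeq_zero, norm_pow, Complex.norm_real, Real.norm_of_nonneg ht0]

/-- The image under `C_t` of the indicator sequence of `{0, …, k}`. -/
noncomputable def cesaroColumn (t : ℝ) (k : ℕ) : ℕ → ℂ :=
  genCesaro t fun j => if j ≤ k then 1 else 0

/-! ### Pointwise estimates of the columns. -/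

section Column

variable {t : ℝ}

theorem one_sub_mul_cesaroColumn {k n : ℕ} (h : n ≤ k) :
    (1 - (t : ℂ)) * (((n : ℂ) + 1) * cesaroColumn t k n) = 1 - (t : ℂ) ^ (n + 1) := by
  induction n with
  | zero => simp [cesaroColumn, genCesaro_zero]
  | succ n ih =>
    have hs := genCesaro_succ t (fun j => if j ≤ k then 1 else 0) n
    rw [if_pos h] at hs
    have ih' := ih (by omega)
    unfold cesaroColumn at ih' ⊢
    push_cast
    linear_combination (1 - (t : ℂ)) * hs + t * ih'

theorem cesaroColumn_add (k j : ℕ) :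
    (((k + j : ℕ) : ℂ) + 1) * cesaroColumn t k (k + j) =
      (t : ℂ) ^ j * (((k : ℂ) + 1) * cesaroColumn t k k) := by
  induction j with
  | zero => simp
  | succ j ih =>
    have hs := genCesaro_succ t (fun j => if j ≤ k then 1 else 0) (k + j)
    rw [if_neg (by omega)] at hs
    unfold cesaroColumn at ih ⊢
    rw [← add_assoc k j 1, pow_succ]
    push_cast at ih hs ⊢
    linear_combination hs + t * ih

variable (ht0 : 0 ≤ t) (ht1 : t < 1)
include ht0 ht1

theorem norm_mul_cesaroColumn_le {k n : ℕ} (h : n ≤ k) :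
    ‖((n : ℂ) + 1) * cesaroColumn t k n‖ ≤ (1 - t)⁻¹ := by
  have hp : 0 < 1 - t := sub_pos.2 ht1
  have h1 := congrArg norm (one_sub_mul_cesaroColumn (t := t) h)
  have e1 : (1 : ℂ) - t = ((1 - t : ℝ) : ℂ) := by push_cast; rfl
  have e2 : (1 : ℂ) - (t : ℂ) ^ (n + 1) = ((1 - t ^ (n + 1) : ℝ) : ℂ) := by push_cast; rfl
  rw [e1, e2, norm_mul, Complex.norm_real, Complex.norm_real, Real.norm_of_nonneg hp.le,
    Real.norm_of_nonneg (sub_nonneg.2 (pow_le_one₀ ht0 ht1.le))] at h1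
  rw [← one_div, le_div_iff₀ hp, mul_comm, h1]
  linarith [pow_nonneg ht0 (n + 1)]

theorem succ_mul_pow_le (n : ℕ) : ((n : ℝ) + 1) * t ^ (n + 1) ≤ (1 - t)⁻¹ := by
  have hp : 0 < 1 - t := sub_pos.2 ht1
  have h1 : ((n : ℝ) + 1) * t ^ (n + 1) ≤ ∑ i ∈ Finset.range (n + 1), t ^ i := by
    have : ((n : ℝ) + 1) * t ^ (n + 1) = ∑ _i ∈ Finset.range (n + 1), t ^ (n + 1) := by simp
    rw [this]
    exact Finset.sum_le_sum fun i hi =>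
      pow_le_pow_of_le_one ht0 ht1.le (Finset.mem_range.1 hi).le
  refine h1.trans ?_
  rw [← one_div, le_div_iff₀ hp, mul_comm, mul_neg_geom_sum]
  linarith [pow_nonneg ht0 (n + 1)]

/-- With `w_n` the numerator of entry `n`, `w_{n+1} - w_n = t^(n+1)`, so the difference times
`(n+1)(n+2)` is `(n+1) t^(n+1) - w_n`. Both terms are at most `(1-t)⁻¹`. -/
theorem norm_cesaroColumn_sub_le {k n : ℕ} (h : n < k) :
    ‖cesaroColumn t k (n + 1) - cesaroColumn t k n‖ ≤
      2 * (1 - t)⁻¹ * (1 / (((n : ℝ) + 1) * ((n : ℝ) + 2))) := by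
  have hs := genCesaro_succ t (fun j => if j ≤ k then 1 else 0) n
  rw [if_pos (by omega)] at hs
  have h1 := one_sub_mul_cesaroColumn (t := t) h.le
  have hw := norm_mul_cesaroColumn_le ht0 ht1 h.le
  have e : ((((n : ℝ) + 1) * ((n : ℝ) + 2) : ℝ) : ℂ) *
      (cesaroColumn t k (n + 1) - cesaroColumn t k n) =
      ((((n : ℝ) + 1) * t ^ (n + 1) : ℝ) : ℂ) - ((n : ℂ) + 1) * cesaroColumn t k n := by
    unfold cesaroColumn at h1 ⊢
    push_cast
    linear_combination ((n : ℂ) + 1) * hs - ((n : ℂ) + 1) * h1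
  have hn := congrArg norm e
  have hpos : 0 < ((n : ℝ) + 1) * ((n : ℝ) + 2) := by positivity
  rw [norm_mul, Complex.norm_real, Real.norm_of_nonneg hpos.le] at hn
  have hb := norm_sub_le ((((n : ℝ) + 1) * t ^ (n + 1) : ℝ) : ℂ)
    (((n : ℂ) + 1) * cesaroColumn t k n)
  rw [Complex.norm_real, Real.norm_of_nonneg (by positivity)] at hb
  rw [mul_one_div, le_div_iff₀ hpos, mul_comm, hn]
  linarith [succ_mul_pow_le ht0 ht1 n]

/-- Past `k` the input is zero, so each step only multiplies the numerator by `t`. -/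
theorem norm_cesaroColumn_add_le (k j : ℕ) :
    ‖cesaroColumn t k (k + j)‖ ≤ (1 - t)⁻¹ * (t ^ j / ((k : ℝ) + 1)) := by
  have h := congrArg norm (cesaroColumn_add (t := t) k j)
  have hw := norm_mul_cesaroColumn_le ht0 ht1 (le_refl k)
  have e : ((k + j : ℕ) : ℂ) + 1 = (((k : ℝ) + j + 1 : ℝ) : ℂ) := by push_cast; rfl
  rw [e, norm_mul, norm_mul ((t : ℂ) ^ j), norm_pow, Complex.norm_real, Complex.norm_real,
    Real.norm_of_nonneg ht0, Real.norm_of_nonneg (by positivity)] at h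
  rw [mul_div_assoc', le_div_iff₀ (by positivity)]
  calc ‖cesaroColumn t k (k + j)‖ * ((k : ℝ) + 1)
      ≤ ((k : ℝ) + j + 1) * ‖cesaroColumn t k (k + j)‖ := by
        rw [mul_comm]
        gcongr
        linarith [Nat.cast_nonneg (α := ℝ) j]
    _ ≤ t ^ j * (1 - t)⁻¹ := by
        rw [h]
        exact mul_le_mul_of_nonneg_left hw (pow_nonneg ht0 j)
    _ = _ := mul_comm _ _

theorem norm_cesaroColumn_add_sub_le (k j : ℕ) :
    ‖cesaroColumn t k (k + j + 1) - cesaroColumn t k (k + j)‖ ≤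
      2 * (1 - t)⁻¹ * (t ^ j / ((k : ℝ) + 1)) := by
  have hp : 0 < 1 - t := sub_pos.2 ht1
  have h1 := norm_cesaroColumn_add_le ht0 ht1 k j
  have h2 : ‖cesaroColumn t k (k + j + 1)‖ ≤ (1 - t)⁻¹ * (t ^ j / ((k : ℝ) + 1)) := by
    refine (norm_cesaroColumn_add_le ht0 ht1 k (j + 1)).trans ?_
    gcongr _ * (?_ / _)
    exact pow_le_pow_of_le_one ht0 ht1.le (Nat.le_succ j)
  linarith [norm_sub_le (cesaroColumn t k (k + j + 1)) (cesaroColumn t k (k + j))]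

end Column

/-! ### Columns against the weight. -/

section Bounded

variable {d : HahnWeight} {t : ℝ}

/-- Compare the quotient at `k` with the one at `0`, for `m = j - 1`. -/
theorem weight_add_le (hd_anti : ∀ m : ℕ, Antitone fun k : ℕ => d (m + k + 1) / d k) (k j : ℕ) :
    d (k + j) ≤ d k * (d j / d 0) := by
  rw [mul_comm, ← div_le_iff₀ (d.pos k)]
  cases j with
  | zero => simp [(d.pos _).ne']
  | succ m =>
    have h := hd_anti m (Nat.zero_le k)
    simp only [add_zero] at h
    rwa [add_comm m k, add_assoc] at h

theorem summable_weight_cesaroColumn (ht0 : 0 ≤ t) (ht1 : t < 1)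
    (hd : ∀ k j, d (k + j) ≤ d k * (d j / d 0)) (hs : Summable fun n => d n * t ^ n) (k : ℕ) :
    Summable fun n => d n * ‖cesaroColumn t k n‖ := by
  have hp : 0 < 1 - t := sub_pos.2 ht1
  rw [← summable_nat_add_iff k]
  refine Summable.of_nonneg_of_le (fun n => mul_nonneg (d.pos _).le (norm_nonneg _)) (fun j => ?_)
    (hs.mul_left (d k / d 0 * (1 - t)⁻¹ / ((k : ℝ) + 1)))
  rw [add_comm j k]
  calc d (k + j) * ‖cesaroColumn t k (k + j)‖
      ≤ (d k * (d j / d 0)) * ((1 - t)⁻¹ * (t ^ j / ((k : ℝ) + 1))) :=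
        mul_le_mul (hd k j) (norm_cesaroColumn_add_le ht0 ht1 k j) (norm_nonneg _)
          (mul_nonneg (d.pos k).le (div_nonneg (d.pos j).le (d.pos 0).le))
    _ = _ := by ring

theorem summable_one_div_succ_mul : Summable fun n : ℕ => 1 / (((n : ℝ) + 1) * ((n : ℝ) + 2)) := by
  refine Summable.of_nonneg_of_le (fun n => by positivity) (fun n => ?_)
    ((summable_nat_add_iff 1).2 (Real.summable_one_div_nat_pow.2 one_lt_two))
  push_cast
  rw [sq]
  gcongr
  norm_num

/-- The weighted means `∑_{n < k} (d_n / d_k) / ((n + 1) (n + 2))` tend to `0`. -/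
theorem tendsto_sum_weight_div (d : HahnWeight) :
    Tendsto (fun k => ∑ n ∈ Finset.range k, d n / d k * (1 / (((n : ℝ) + 1) * ((n : ℝ) + 2))))
      atTop (𝓝 0) := by
  -- Monotonicity of `d` gives the majorant, `d_k → ∞` the termwise limit.
  have h := tendsto_tsum_of_dominated_convergence (𝓕 := atTop) summable_one_div_succ_mul
    (f := fun k n : ℕ => if n < k then d n / d k * (1 / (((n : ℝ) + 1) * ((n : ℝ) + 2))) else 0)
    (g := fun _ => 0) ?_ ?_
  · rw [tsum_zero] at h
    refine h.congr fun k => ?_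
    rw [tsum_eq_sum (s := Finset.range k)]
    · exact Finset.sum_congr rfl fun n hn => if_pos (Finset.mem_range.1 hn)
    · exact fun n hn => if_neg fun hn' => hn (Finset.mem_range.2 hn')
  · intro n
    have h1 : Tendsto (fun k => d n / d k * (1 / (((n : ℝ) + 1) * ((n : ℝ) + 2)))) atTop (𝓝 0) := by
      simpa using (d.tendsto_atTop.const_div_atTop (d n)).mul_const _
    refine h1.congr' ?_
    filter_upwards [eventually_gt_atTop n] with k hk using (if_pos hk).symm
  · refine Eventually.of_forall fun k n => ?_
    split_ifs with hnk
    · rw [Real.norm_of_nonneg (mul_nonneg (div_nonneg (d.pos n).le (d.pos k).le) (by positivity))]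
      refine mul_le_of_le_one_left (by positivity) ?_
      rw [div_le_one (d.pos k)]
      exact d.mono hnk.le
    · rw [norm_zero]
      positivity

/-- The norm is split at `n = k`; in the tail, `d (k + j) ≤ d k * (d j / d 0)` lets `d k` cancel. -/
theorem tsum_weight_cesaroColumn_div_le (ht0 : 0 ≤ t) (ht1 : t < 1)
    (hd : ∀ k j, d (k + j) ≤ d k * (d j / d 0)) (hs : Summable fun n => d n * t ^ n) (k : ℕ) :
    (∑' n, d n * ‖cesaroColumn t k (n + 1) - cesaroColumn t k n‖) / d k ≤
      2 * (1 - t)⁻¹ * (∑ n ∈ Finset.range k, d n / d k * (1 / (((n : ℝ) + 1) * ((n : ℝ) + 2)))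
        + (∑' n, d n * t ^ n) / d 0 * (1 / ((k : ℝ) + 1))) := by
  have hp : 0 < 1 - t := sub_pos.2 ht1
  have hsum := HahnSpace.summable_diff_of_summable
    (summable_weight_cesaroColumn ht0 ht1 hd hs k)
  rw [← hsum.sum_add_tsum_nat_add k, add_div, mul_add]
  refine add_le_add ?_ ?_
  · rw [Finset.sum_div, Finset.mul_sum]
    refine Finset.sum_le_sum fun n hn => ?_
    have h := norm_cesaroColumn_sub_le ht0 ht1 (Finset.mem_range.1 hn)
    calc d n * ‖cesaroColumn t k (n + 1) - cesaroColumn t k n‖ / d k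
        = d n / d k * ‖cesaroColumn t k (n + 1) - cesaroColumn t k n‖ := by ring
      _ ≤ d n / d k * (2 * (1 - t)⁻¹ * (1 / (((n : ℝ) + 1) * ((n : ℝ) + 2)))) :=
          mul_le_mul_of_nonneg_left h (div_nonneg (d.pos n).le (d.pos k).le)
      _ = _ := by ring
  · rw [div_le_iff₀ (d.pos k)]
    have hb : ∀ j, d (j + k) * ‖cesaroColumn t k (j + k + 1) - cesaroColumn t k (j + k)‖ ≤
        (d k * (2 * (1 - t)⁻¹) / d 0 * (1 / ((k : ℝ) + 1))) * (d j * t ^ j) := fun j => by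
      rw [add_comm j k]
      calc _ ≤ (d k * (d j / d 0)) * (2 * (1 - t)⁻¹ * (t ^ j / ((k : ℝ) + 1))) :=
            mul_le_mul (hd k j) (norm_cesaroColumn_add_sub_le ht0 ht1 k j) (norm_nonneg _)
              (mul_nonneg (d.pos k).le (div_nonneg (d.pos j).le (d.pos 0).le))
        _ = _ := by ring
    refine (((summable_nat_add_iff k).2 hsum).tsum_le_tsum hb (hs.mul_left _)).trans_eq ?_
    rw [tsum_mul_left]
    ring

end Bounded

theorem exists_compact_genCesaro (d : HahnWeight)
    (hd_anti : ∀ m : ℕ, Antitone fun k : ℕ => d (m + k + 1) / d k)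
    (hd_lim : Tendsto (fun k : ℕ => d (k + 1) / d k) atTop (𝓝 1))
    {t : ℝ} (ht0 : 0 ≤ t) (ht1 : t < 1) :
    ∃ C : HahnSpace d →L[ℂ] HahnSpace d,
      (∀ x : HahnSpace d, (C x).toSeq = genCesaro t x.toSeq) ∧ IsCompactOperator C := by
  have hd := weight_add_le hd_anti
  have hs := summable_weight_mul_pow d hd_lim ht0 ht1
  let c : ℕ → HahnSpace d := fun k =>
    HahnSpace.ofSummable (cesaroColumn t k) (summable_weight_cesaroColumn ht0 ht1 hd hs k)
  have hle : ∀ k, ‖c k‖ / d k ≤ _ := fun k => tsum_weight_cesaroColumn_div_le ht0 ht1 hd hs k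
  have hlim : Tendsto (fun k => ‖c k‖ / d k) atTop (𝓝 0) := by
    refine squeeze_zero (fun k => div_nonneg (norm_nonneg _) (d.pos k).le) hle ?_
    have h := ((tendsto_sum_weight_div d).add
      ((tendsto_one_div_add_atTop_nhds_zero_nat (𝕜 := ℝ)).const_mul
        ((∑' n, d n * t ^ n) / d 0))).const_mul (2 * (1 - t)⁻¹)
    simpa using h
  obtain ⟨M, hM⟩ := hlim.bddAbove_range
  have hcM : ∀ k, ‖c k‖ ≤ M * d k := fun k =>
    (div_le_iff₀ (d.pos k)).1 (hM (Set.mem_range_self k))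
  refine ⟨HahnSpace.ofColumns c M hcM, fun x => funext fun n => ?_,
    HahnSpace.isCompactOperator_ofColumns c M hcM hlim⟩
  have h1 : HasSum (fun k => (x k - x (k + 1)) * cesaroColumn t k n)
      ((HahnSpace.ofColumns c M hcM x) n) :=
    (HahnSpace.coord d n).hasSum (HahnSpace.summable_smul_column hcM x).hasSum
  -- Each entry of `C_t x` involves finitely many coordinates, so their expansions may be summed
  -- termwise.
  have h2 : HasSum (fun k => (∑ j ∈ Finset.range (n + 1),
      (t : ℂ) ^ (n - j) * (if j ≤ k then x k - x (k + 1) else 0)) / ((n : ℂ) + 1))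
      (genCesaro t x.toSeq n) :=
    (hasSum_sum fun j _ => (x.hasSum_sub_succ j).mul_left ((t : ℂ) ^ (n - j))).div_const _
  refine h1.unique (h2.congr_fun fun k => ?_)
  rw [cesaroColumn, genCesaro_apply, mul_div_assoc', Finset.mul_sum]
  congr 1
  refine Finset.sum_congr rfl fun j _ => ?_
  split_ifs <;> ring

/-! ### Spectral radius, powers and orbits. -/

theorem hasEigenvalue_iff_exists {E : Type*} [NormedAddCommGroup E] [NormedSpace ℂ E]
    {T : E →L[ℂ] E} {μ : ℂ} :
    Module.End.HasEigenvalue (T : E →ₗ[ℂ] E) μ ↔ ∃ x, x ≠ 0 ∧ T x = μ • x := by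
  constructor
  · intro h
    obtain ⟨x, hx⟩ := h.exists_hasEigenvector
    exact ⟨x, hx.2, hx.apply_eq_smul⟩
  · rintro ⟨x, h0, hx⟩
    exact Module.End.hasEigenvalue_of_hasEigenvector (Module.End.hasEigenvector_iff.2
      ⟨Module.End.mem_eigenspace_iff.2 hx, h0⟩)

/-- The powers of an element of a Banach algebra of spectral radius less than `1` tend to `0`. -/
theorem tendsto_pow_zero_of_spectralRadius_lt_one {A : Type*} [NormedRing A] [NormedAlgebra ℂ A]
    [CompleteSpace A] {a : A} (h : spectralRadius ℂ a < 1) :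
    Tendsto (fun n : ℕ => a ^ n) atTop (𝓝 0) := by
  obtain ⟨r, hr, hr1⟩ := ENNReal.lt_iff_exists_nnreal_btwn.1 h
  have hr1' : r < 1 := by exact_mod_cast hr1
  rw [tendsto_zero_iff_norm_tendsto_zero]
  -- Gelfand's formula: eventually `‖a^n‖ ≤ r^n`.
  have hev := (spectrum.pow_nnnorm_pow_one_div_tendsto_nhds_spectralRadius a).eventually
    (gt_mem_nhds hr)
  refine squeeze_zero' (Eventually.of_forall fun _ => norm_nonneg _) ?_
    (tendsto_pow_atTop_nhds_zero_of_lt_one r.coe_nonneg (by exact_mod_cast hr1'))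
  filter_upwards [hev, eventually_gt_atTop 0] with n hn hn0
  have hn0' : (0 : ℝ) < n := by exact_mod_cast hn0
  rw [one_div, ENNReal.rpow_inv_lt_iff hn0', ENNReal.rpow_natCast] at hn
  exact_mod_cast hn.le

section Consequences

variable {E : Type*} [NormedAddCommGroup E] [NormedSpace ℂ E] {T P : E →L[ℂ] E}

theorem IsPowerBounded.of_tendsto (h : Tendsto (fun n : ℕ => T ^ n) atTop (𝓝 P)) :
    IsPowerBounded T := by
  obtain ⟨M, hM⟩ := h.norm.bddAbove_range
  exact ⟨M, fun n _ => hM (Set.mem_range_self n)⟩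

theorem IsUniformlyMeanErgodic.of_tendsto (h : Tendsto (fun n : ℕ => T ^ n) atTop (𝓝 P)) :
    IsUniformlyMeanErgodic T := by
  refine ⟨P, (((tendsto_add_atTop_iff_nat 1).2 h).cesaro_smul).congr fun n => ?_⟩
  have hI : Finset.Icc 1 n = Finset.Ico (0 + 1) (n + 1) := by
    ext k
    simp only [Finset.mem_Icc, Finset.mem_Ico]
    omega
  rw [cesaroMean, hI, ← Finset.sum_Ico_add', ← Finset.range_eq_Ico, ← Complex.coe_smul]
  push_cast
  rfl

/-- If `P` is a projection, `T P = P T = P` and `T - P` has spectral radius less than `1` then `T ^ n` tends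
to `P`. -/
theorem tendsto_pow_of_spectralRadius_sub_lt_one [CompleteSpace E] (hPP : P * P = P)
    (hTP : T * P = P) (hPT : P * T = P) (h : spectralRadius ℂ (T - P) < 1) :
    Tendsto (fun n : ℕ => T ^ n) atTop (𝓝 P) := by
  have hz : (T - P) * P = 0 := by rw [sub_mul, hTP, hPP, sub_self]
  have hpow : ∀ n : ℕ, T ^ (n + 1) = (T - P) ^ (n + 1) + P := by
    intro n
    induction n with
    | zero => simp
    | succ n ih =>
      have h1 : (T - P) ^ (n + 1) * P = 0 := by rw [pow_succ, mul_assoc, hz, mul_zero]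
      rw [pow_succ, ih, pow_succ (T - P) (n + 1), add_mul, hPT, mul_sub, h1, sub_zero]
  rw [← tendsto_add_atTop_iff_nat 1]
  simp only [hpow]
  simpa using ((tendsto_add_atTop_iff_nat 1).2
    (tendsto_pow_zero_of_spectralRadius_lt_one h)).add_const P

/-- An operator whose transpose has the eigenvalue `1` and an eigenvalue of modulus at most `1`,
with independent eigenvectors, is not supercyclic. -/
theorem not_isSupercyclic_of_functionals {f g : E →L[ℂ] ℂ} {a : ℂ} (ha : ‖a‖ ≤ 1)
    (hf : ∀ x, f (T x) = f x) (hg : ∀ x, g (T x) = a * g x) {u v : E} (hu : f u ≠ 0)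
    (hv : f v = 0) (hv' : g v ≠ 0) : ¬ IsSupercyclic T := by
  rintro ⟨x, hx⟩
  have hfn : ∀ n : ℕ, f ((T ^ n) x) = f x := by
    intro n
    induction n with
    | zero => simp
    | succ n ih => rw [pow_succ', mul_apply_eq_comp, hf, ih]
  have hgn : ∀ n : ℕ, ‖g ((T ^ n) x)‖ ≤ ‖g x‖ := by
    intro n
    induction n with
    | zero => simp
    | succ n ih =>
      rw [pow_succ', mul_apply_eq_comp, hg, norm_mul]
      exact (mul_le_of_le_one_left (norm_nonneg _) ha).trans ih
  -- This bound on `|g| / |f|` holds along the projective orbit and is a closed condition. At `v` it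
  -- forces `f x = 0`; then `f` vanishes on the orbit, hence at `u`.
  have key : ∀ y, ‖f x‖ * ‖g y‖ ≤ ‖g x‖ * ‖f y‖ := by
    have hc : IsClosed {y : E | ‖f x‖ * ‖g y‖ ≤ ‖g x‖ * ‖f y‖} :=
      isClosed_le (by fun_prop) (by fun_prop)
    intro y
    refine hc.closure_subset_iff.2 ?_ (hx y)
    rintro _ ⟨c, n, rfl⟩
    simp only [Set.mem_ofPred_eq, map_smul, norm_smul, hfn]
    calc ‖f x‖ * (‖c‖ * ‖g ((T ^ n) x)‖) ≤ ‖f x‖ * (‖c‖ * ‖g x‖) := by gcongr; exact hgn n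
      _ = _ := by ring
  have hfx : f x = 0 := by
    by_contra hne
    have h := key v
    rw [hv, norm_zero, mul_zero] at h
    exact absurd h (not_le.2 (mul_pos (norm_pos_iff.2 hne) (norm_pos_iff.2 hv')))
  have hc : IsClosed {y : E | f y = 0} := isClosed_eq (by fun_prop) continuous_const
  refine hu (hc.closure_subset_iff.2 ?_ (hx u))
  rintro _ ⟨c, n, rfl⟩
  rw [Set.mem_ofPred_eq, map_smul, hfn, hfx, smul_zero]

end Consequences

/-! ### The main theorem. -/

theorem theoremT12p5 (d : HahnWeight) (hd_one : ∀ n, 1 ≤ d n)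
    (hd_anti : ∀ m : ℕ, Antitone fun k : ℕ => d (m + k + 1) / d k)
    (hd_lim : Tendsto (fun k : ℕ => d (k + 1) / d k) atTop (𝓝 1))
    (t : ℝ) (ht0 : 0 ≤ t) (ht1 : t < 1) :
    ∃ C : HahnSpace d →L[ℂ] HahnSpace d,
      (∀ x : HahnSpace d, (C x).toSeq = genCesaro t x.toSeq) ∧
      IsCompactOperator C ∧
      pointSpectrum C = cesaroLambda ∧
      spectrum ℂ C = cesaroLambda ∪ {0} ∧
      IsPowerBounded C ∧
      IsUniformlyMeanErgodic C ∧
      ¬ IsSupercyclic C := by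
  obtain ⟨C, hC, hcomp⟩ := exists_compact_genCesaro d hd_anti hd_lim ht0 ht1
  have hCn : ∀ x n, (C x) n = genCesaro t x.toSeq n := fun x n => congrFun (hC x) n
  have hC0 : ∀ x, (C x) 0 = x 0 := fun x => by rw [hCn, genCesaro_zero]
  have hC1 : ∀ x, 2 * (C x) 1 = t * x 0 + x 1 := fun x => by
    have h := genCesaro_succ t x.toSeq 0
    rw [genCesaro_zero] at h
    rw [hCn]
    simpa using h
  have hex : ∀ x : HahnSpace d, x ≠ 0 → ∃ n, x n ≠ 0 := fun x hx => by
    by_contra! h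
    exact hx (HahnSpace.ext h)
  let v : ℕ → HahnSpace d := fun m => HahnSpace.ofSummable (cesaroEigenSeq t m)
    (summable_weight_cesaroEigenSeq d hd_lim ht0 ht1 m)
  have hv : ∀ m n, v m n = cesaroEigenSeq t m n := fun _ _ => rfl
  have hCv : ∀ m, C (v m) = (1 / ((m : ℂ) + 1)) • v m := fun m => HahnSpace.ext fun n => by
    rw [hCn, HahnSpace.smul_apply]
    exact genCesaro_cesaroEigenSeq t m n
  have hv0 : v 0 0 = 1 := cesaroEigenSeq_self t 0
  have hv1 : v 1 1 = 1 := cesaroEigenSeq_self t 1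
  have hv10 : v 1 0 = 0 := by simp [hv, cesaroEigenSeq]
  have hvne : ∀ m, v m ≠ 0 := fun m h => by
    have h1 : v m m = 1 := cesaroEigenSeq_self t m
    rw [h, HahnSpace.zero_apply] at h1
    exact zero_ne_one h1
  have hpt : pointSpectrum C = cesaroLambda := by
    ext μ
    rw [pointSpectrum, Set.mem_ofPred_eq, hasEigenvalue_iff_exists]
    constructor
    · rintro ⟨x, hx0, hx⟩
      obtain ⟨n, -, hn⟩ := exists_eq_of_genCesaro_eq (t := t) (hex x hx0) (μ := μ)
        fun n => by rw [← hCn, hx, HahnSpace.smul_apply]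
      exact ⟨n, hn.symm⟩
    · rintro ⟨m, rfl⟩
      exact ⟨v m, hvne m, hCv m⟩
  have hne0 : (0 : ℂ) ∉ cesaroLambda := by
    rintro ⟨n, hn⟩
    exact one_div_ne_zero (by exact_mod_cast n.succ_ne_zero) hn
  have hmem : ∀ μ : ℂ, μ ≠ 0 → (μ ∈ spectrum ℂ C ↔ μ ∈ cesaroLambda) := fun μ hμ => by
    rw [← hcomp.hasEigenvalue_iff_mem_spectrum hμ, ← hpt]
    rfl
  have hspec : spectrum ℂ C = cesaroLambda ∪ {0} := by
    have h0 : (0 : ℂ) ∈ spectrum ℂ C := by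
      refine (spectrum.isClosed C).mem_of_tendsto
        (tendsto_one_div_add_atTop_nhds_zero_nat (𝕜 := ℂ)) (Eventually.of_forall fun n => ?_)
      have hn : (1 / ((n : ℂ) + 1)) ∈ cesaroLambda := ⟨n, rfl⟩
      exact (hmem _ fun h => hne0 (h ▸ hn)).2 hn
    ext μ
    by_cases hμ : μ = 0
    · simp [hμ, h0]
    · simp [hμ, hmem μ hμ]
  let P : HahnSpace d →L[ℂ] HahnSpace d := (HahnSpace.coord d 0).smulRight (v 0)
  have hP : ∀ x, P x = x 0 • v 0 := fun _ => rfl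
  have hPcomp : IsCompactOperator P :=
    (isCompactOperator_of_locallyCompactSpace_dom (HahnSpace.coord d 0)).clm_comp
      ((ContinuousLinearMap.id ℂ ℂ).smulRight (v 0))
  have hCv0 : C (v 0) = v 0 := by simpa using hCv 0
  -- Coordinate `0` of `(C - P) x` is zero, so an eigenvector for `μ ≠ 0` has `x 0 = 0`. It is then
  -- an eigenvector of `C` whose first nonzero index is positive, so `|μ| ≤ 1/2`.
  have hrad : spectralRadius ℂ (C - P) < 1 := by
    refine lt_of_le_of_lt (b := ((1 / 2 : NNReal) : ENNReal)) (iSup₂_le fun μ hμ => ?_)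
      (by exact_mod_cast one_half_lt_one (α := NNReal))
    by_cases h0 : μ = 0
    · simp [h0]
    obtain ⟨x, hx0, hx⟩ := hasEigenvalue_iff_exists.1
      (((hcomp.sub hPcomp : IsCompactOperator (C - P))).hasEigenvalue_iff_mem_spectrum h0 |>.2 hμ)
    rw [sub_apply, hP] at hx
    have hx00 : x 0 = 0 := by
      have h := congrArg (HahnSpace.coord d 0) hx
      simp only [map_sub, map_smul, HahnSpace.coord_apply, hC0, hv0, smul_eq_mul, mul_one,
        sub_self] at h
      exact (mul_eq_zero.1 h.symm).resolve_left h0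
    rw [hx00, zero_smul, sub_zero] at hx
    obtain ⟨n, hxn, rfl⟩ := exists_eq_of_genCesaro_eq (t := t) (hex x hx0) (μ := μ)
      fun n => by rw [← hCn, hx, HahnSpace.smul_apply]
    have hn : 1 ≤ n := Nat.one_le_iff_ne_zero.2 fun h => hxn (h ▸ hx00)
    rw [ENNReal.coe_le_coe, ← NNReal.coe_le_coe, coe_nnnorm]
    have e : (1 : ℂ) / ((n : ℂ) + 1) = ((1 / ((n : ℝ) + 1) : ℝ) : ℂ) := by push_cast; rfl
    rw [e, Complex.norm_real, Real.norm_of_nonneg (by positivity)]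
    have hn' : (1 : ℝ) ≤ n := by exact_mod_cast hn
    push_cast
    exact one_div_le_one_div_of_le two_pos (by linarith)
  have hpow : Tendsto (fun n : ℕ => C ^ n) atTop (𝓝 P) := by
    refine tendsto_pow_of_spectralRadius_sub_lt_one ?_ ?_ ?_ hrad
    · ext1 x
      rw [mul_apply_eq_comp, hP, hP, HahnSpace.smul_apply, hv0, mul_one]
    · ext1 x
      rw [mul_apply_eq_comp, hP, map_smul, hCv0]
    · ext1 x
      rw [mul_apply_eq_comp, hP, hP, hC0]
  refine ⟨C, hC, hcomp, hpt, hspec, .of_tendsto hpow, .of_tendsto hpow, ?_⟩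
  -- `x_0` is invariant under `C`, while `x_1 - t x_0` is halved.
  refine not_isSupercyclic_of_functionals (f := HahnSpace.coord d 0)
    (g := HahnSpace.coord d 1 - (t : ℂ) • HahnSpace.coord d 0) (a := 1 / 2) (by norm_num)
    hC0 (fun x => ?_) (u := v 0) (v := v 1) ?_ hv10 ?_
  · simp only [sub_apply, smul_apply, HahnSpace.coord_apply, hC0, smul_eq_mul]
    linear_combination (1 / 2 : ℂ) * hC1 x
  · rw [HahnSpace.coord_apply, hv0]
    exact one_ne_zero
  · simp [hv1, hv10]
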